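/- Let $q$ be an odd prime power. For $F, x \in \mathbb{F}_q[T]$ with $F \neq 0$, let $\deg_F x$ denote the degree of the unique $x' \in \mathbb{F}_q[T]$ with $\deg x' < \deg F$ and $x' \equiv x \pmod F$, where $\deg 0 = -\infty$. For an integer $m \ge 0$ let $E_{F,2}^{\sqrt{}}(\mathbf{1}_m)$ be the number of $4$-tuples $(x_1,x_2,x_3,x_4)$ of polynomials in $\mathbb{F}_q[T]$ of degree less than $\deg F$ such that $x_1+x_2 \equiv x_3+x_4 \pmod F$ and $\deg_F(x_i^2) < m$ for $i=1,2,3,4$. Then there is a function $g=g_q : \mathbb{Z}_{\ge 0} \to \mathbb{R}$, depending only on $q$, with $g(m) = o(m)$ as $m \to \infty$, such that for every irreducible $F \in \mathbb{F}_q[T]$, with $r = \deg F$, and every integer $m$ with $0 \le m \le r$, $$E_{F,2}^{\sqrt{}}(\mathbf{1}_m) \le q^{g(m)}\left(q^{7m/2-r/2} + q^{2m}\right).$$ -/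

import Mathlib

open Polynomial Filter Asymptotics

/-- `degMod F x` is `deg_F x`: the degree of the residue of `x` modulo `F` of degree less than
`deg F`, with the convention `deg 0 = ⊥` (that is, `-∞`). -/
noncomputable def degMod {K : Type*} [Field K] (F x : K[X]) : WithBot ℕ :=
  (x % F).degree

/-- `degMod F x` is the degree of any `x'` with `deg x' < deg F` and `x' ≡ x mod F`. -/
theorem degMod_eq_degree {K : Type*} [Field K] {F x x' : K[X]}
    (hdeg : x'.degree < F.degree) (hmod : F ∣ x' - x) : degMod F x = x'.degree := by
  have h : x' % F = x % F := by
    rw [← sub_eq_zero, ← Polynomial.sub_mod]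
    exact (EuclideanDomain.mod_eq_zero).2 hmod
  have hx' : x' % F = x' := (Polynomial.mod_eq_self_iff (by rintro rfl; simp at hdeg)).2 hdeg
  rw [degMod, ← h, hx']

/-- The quadruples `(x₁, x₂, x₃, x₄)` (indexed from `0`) of polynomials of degree less than `deg F`
with `x₁ + x₂ ≡ x₃ + x₄ mod F` and `deg_F (xᵢ ^ 2) < m` for every `i`. -/
def modularRootQuadruples {K : Type*} [Field K] (F : K[X]) (m : ℕ) : Set (Fin 4 → K[X]) :=
  {x | (∀ i, (x i).degree < F.degree) ∧ (∀ i, degMod F (x i ^ 2) < (m : WithBot ℕ)) ∧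
    F ∣ (x 0 + x 1) - (x 2 + x 3)}

/-- Over a finite field there are only finitely many such quadruples, so that their number
is meaningful as the natural number `Set.ncard`. -/
theorem modularRootQuadruples_finite {K : Type*} [Field K] [Finite K] (F : K[X]) (m : ℕ) :
    (modularRootQuadruples F m).Finite := by
  have hfin : {p : K[X] | p.degree < F.degree}.Finite := by
    have : Finite (degreeLT K F.natDegree) :=
      Finite.of_equiv _ (degreeLTEquiv K F.natDegree).symm.toEquiv
    refine (Set.toFinite (degreeLT K F.natDegree : Set K[X])).subset fun p hp => ?_
    exact mem_degreeLT.2 (lt_of_lt_of_le hp degree_le_natDegree)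
  exact (Set.Finite.pi' fun _ : Fin 4 => hfin).subset fun x hx => hx.1

/-- The additive energy of modular square roots: the number of quadruples of residues modulo `F`
with `x₁ + x₂ ≡ x₃ + x₄ mod F` and `deg_F (xᵢ ^ 2) < m`. -/
noncomputable def modularRootEnergy {K : Type*} [Field K] (F : K[X]) (m : ℕ) : ℕ :=
  (modularRootQuadruples F m).ncard

/-!
The energy is `∑ l, r l ^ 2`, where `r l` counts the pairs `(x, y)` of small square roots with sum
`l`. For `l ≠ 0` such a pair is determined by the residues `u` of `y ^ 2 - x ^ 2` and `v` of
`x ^ 2 + y ^ 2`, which have degree less than `m` and lie on the parabola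
`u ^ 2 ≡ 2 * l ^ 2 * v - l ^ 4` modulo `F`. By the pigeonhole principle, `2 * l ^ 2 ≡ c / a` with
`a` and `c` small and coprime; then `a * u ^ 2 - c * v` is constant modulo `F` and takes few values.
Two points with the same value have `c ∣ (u - b) * (u + b)`, so each factorisation `c = d * e`
confines `u` to a class modulo `lcm d e`; the factors `gcd d e` lost there are recovered because
`gcd d e ^ 2` divides the value of the form. The divisor bound controls the number of
factorisations, and since each fraction `c / a` arises from at most two `l`, the resulting bounds
for `r l ^ 2` can be averaged over all small `a` and `c`.
-/

section BoundedDegree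

theorem degree_mul_lt_add {R : Type*} [Semiring R] {f g : R[X]} {k n : ℕ} (hf : f.degree ≤ k)
    (hg : g.degree < n) : (f * g).degree < (k + n : ℕ) := by
  by_cases h0 : f * g = 0
  · rw [h0, degree_zero]
    exact WithBot.bot_lt_coe _
  have hg0 := right_ne_zero_of_mul h0
  refine (natDegree_lt_iff_degree_lt h0).1 (natDegree_mul_le.trans_lt ?_)
  exact add_lt_add_of_le_of_lt (natDegree_le_iff_degree_le.2 hf)
    ((natDegree_lt_iff_degree_lt hg0).2 hg)

theorem degree_lt_sub_of_degree_mul_lt {R : Type*} [Semiring R] [NoZeroDivisors R] {d f : R[X]}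
    {n : ℕ} (hd : d ≠ 0) (h : (d * f).degree < n) : f.degree < (n - d.natDegree : ℕ) := by
  rcases eq_or_ne f 0 with rfl | hf
  · rw [degree_zero]
    exact WithBot.bot_lt_coe _
  rw [← natDegree_lt_iff_degree_lt (mul_ne_zero hd hf), natDegree_mul hd hf] at h
  rw [← natDegree_lt_iff_degree_lt hf]
  omega

variable (K : Type*) [Field K] [Fintype K]

/-- The finite set of polynomials of degree less than `n` over a finite field, that is, Mathlib's
submodule `degreeLT K n` as a `Finset`. -/
noncomputable def degreeLTFinset (n : ℕ) : Finset K[X] :=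
  Finset.univ.map ((degreeLTEquiv K n).symm.toEquiv.toEmbedding.trans (.subtype _))

open Classical in
/-- The finite set of nonzero polynomials of degree less than `n` over a finite field. -/
noncomputable def nonzeroDegreeLTFinset (n : ℕ) : Finset K[X] :=
  (degreeLTFinset K n).erase 0

theorem card_degreeLTFinset (n : ℕ) : (degreeLTFinset K n).card = Fintype.card K ^ n := by
  simp [degreeLTFinset]

variable {K}

theorem mem_degreeLTFinset {n : ℕ} {f : K[X]} : f ∈ degreeLTFinset K n ↔ f.degree < n := by
  rw [← mem_degreeLT]
  constructor
  · intro hf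
    obtain ⟨c, -, rfl⟩ := Finset.mem_map.1 hf
    exact Subtype.coe_prop _
  · exact fun hf => Finset.mem_map.2 ⟨degreeLTEquiv K n ⟨f, hf⟩, Finset.mem_univ _, by simp⟩

theorem mem_nonzeroDegreeLTFinset {n : ℕ} {f : K[X]} :
    f ∈ nonzeroDegreeLTFinset K n ↔ f ≠ 0 ∧ f.natDegree < n := by
  classical
  rw [nonzeroDegreeLTFinset, Finset.mem_erase, mem_degreeLTFinset]
  exact and_congr_right fun hf => (natDegree_lt_iff_degree_lt hf).symm

theorem card_le_of_dvd_sub {W : Finset K[X]} {d : K[X]} (hd : d ≠ 0) {n : ℕ}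
    (hdvd : ∀ u ∈ W, ∀ u' ∈ W, d ∣ u - u') (hdeg : ∀ u ∈ W, ∀ u' ∈ W, (u - u').degree < n) :
    W.card ≤ Fintype.card K ^ (n - d.natDegree) := by
  rcases W.eq_empty_or_nonempty with rfl | ⟨u₀, hu₀⟩
  · exact Nat.zero_le _
  have hquot : ∀ u ∈ W, d * ((u - u₀) / d) = u - u₀ := fun u hu =>
    EuclideanDomain.mul_div_cancel' hd (hdvd u hu u₀ hu₀)
  rw [← card_degreeLTFinset]
  refine Finset.card_le_card_of_injOn (fun u => (u - u₀) / d) (fun u hu => ?_)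
    fun u hu u' hu' huu' => ?_
  · refine Finset.mem_coe.2 (mem_degreeLTFinset.2 (degree_lt_sub_of_degree_mul_lt hd ?_))
    rw [hquot u hu]
    exact hdeg u hu u₀ hu₀
  · have h := congrArg (d * ·) huu'
    simp only [hquot u hu, hquot u' hu'] at h
    exact sub_left_injective h

theorem card_natDegree_eq_le (n j : ℕ) :
    ((nonzeroDegreeLTFinset K n).filter (·.natDegree = j)).card ≤ Fintype.card K ^ (j + 1) := by
  rw [← card_degreeLTFinset]
  refine Finset.card_le_card fun f hf => ?_
  obtain ⟨hf, hj⟩ := Finset.mem_filter.1 hf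
  rw [mem_degreeLTFinset, ← natDegree_lt_iff_degree_lt (mem_nonzeroDegreeLTFinset.1 hf).1, hj]
  exact j.lt_succ_self

theorem sum_inv_card_pow_natDegree_le (n : ℕ) :
    ∑ f ∈ nonzeroDegreeLTFinset K n, ((Fintype.card K : ℝ) ^ f.natDegree)⁻¹ ≤
      Fintype.card K * n := by
  have hq : (0 : ℝ) < Fintype.card K := by exact_mod_cast Fintype.card_pos
  calc ∑ f ∈ nonzeroDegreeLTFinset K n, ((Fintype.card K : ℝ) ^ f.natDegree)⁻¹
      = ∑ j ∈ Finset.range n, ((nonzeroDegreeLTFinset K n).filter (·.natDegree = j)).card *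
          ((Fintype.card K : ℝ) ^ j)⁻¹ := by
        rw [← Finset.sum_fiberwise_of_maps_to (t := Finset.range n) (g := natDegree)
          fun f hf => Finset.mem_range.2 (mem_nonzeroDegreeLTFinset.1 hf).2]
        refine Finset.sum_congr rfl fun j _ => ?_
        rw [← nsmul_eq_mul]
        exact Finset.sum_eq_card_nsmul fun f hf => by rw [(Finset.mem_filter.1 hf).2]
    _ ≤ ∑ j ∈ Finset.range n, (Fintype.card K : ℝ) ^ (j + 1) * ((Fintype.card K : ℝ) ^ j)⁻¹ := by
        gcongr with j
        exact_mod_cast card_natDegree_eq_le n j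
    _ = ∑ _j ∈ Finset.range n, (Fintype.card K : ℝ) :=
        Finset.sum_congr rfl fun j _ => by
          rw [pow_succ', mul_inv_cancel_right₀ (pow_pos hq j).ne']
    _ = Fintype.card K * n := by rw [Finset.sum_const, Finset.card_range, nsmul_eq_mul, mul_comm]

end BoundedDegree

section Divisors

open UniqueFactorizationMonoid

variable {K : Type*} [Field K]

theorem sum_count_normalizedFactors_mul_natDegree [DecidableEq K] {f : K[X]} (hf : f ≠ 0) :
    ∑ p ∈ (normalizedFactors f).toFinset, (normalizedFactors f).count p * p.natDegree =
      f.natDegree := by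
  simp only [← smul_eq_mul]
  rw [← Finset.sum_multiset_map_count,
    ← natDegree_multiset_prod _ (zero_notMem_normalizedFactors f)]
  exact natDegree_eq_of_degree_eq (degree_eq_degree_of_associated (prod_normalizedFactors hf))

theorem ne_zero_and_natDegree_pos_of_mem_normalizedFactors [DecidableEq K] {f p : K[X]}
    (hp : p ∈ (normalizedFactors f).toFinset) : p ≠ 0 ∧ 0 < p.natDegree :=
  have h := irreducible_of_normalized_factor p (Multiset.mem_toFinset.1 hp)
  ⟨h.ne_zero, h.natDegree_pos⟩

theorem prod_count_large_factors_le [DecidableEq K] {f : K[X]} (hf : f ≠ 0) (D : ℕ) :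
    ∏ p ∈ (normalizedFactors f).toFinset with ¬ p.natDegree ≤ D,
        ((normalizedFactors f).count p + 1) ≤ 2 ^ (f.natDegree / (D + 1)) := by
  set large := (normalizedFactors f).toFinset.filter (¬ ·.natDegree ≤ D)
  have hsum : (∑ p ∈ large, (normalizedFactors f).count p) * (D + 1) ≤ f.natDegree :=
    calc (∑ p ∈ large, (normalizedFactors f).count p) * (D + 1)
        = ∑ p ∈ large, (normalizedFactors f).count p * (D + 1) := Finset.sum_mul ..
      _ ≤ ∑ p ∈ large, (normalizedFactors f).count p * p.natDegree :=
          Finset.sum_le_sum fun p hp =>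
            Nat.mul_le_mul_left _ (not_le.1 (Finset.mem_filter.1 hp).2)
      _ ≤ ∑ p ∈ (normalizedFactors f).toFinset, (normalizedFactors f).count p * p.natDegree :=
          Finset.sum_le_sum_of_subset (Finset.filter_subset _ _)
      _ = f.natDegree := sum_count_normalizedFactors_mul_natDegree hf
  calc ∏ p ∈ large, ((normalizedFactors f).count p + 1)
      ≤ ∏ p ∈ large, 2 ^ (normalizedFactors f).count p :=
        Finset.prod_le_prod' fun _ _ => Nat.lt_two_pow_self
    _ = 2 ^ ∑ p ∈ large, (normalizedFactors f).count p := Finset.prod_pow_eq_pow_sum ..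
    _ ≤ 2 ^ (f.natDegree / (D + 1)) :=
        Nat.pow_le_pow_right two_pos ((Nat.le_div_iff_mul_le D.succ_pos).2 hsum)

variable [Fintype K]

open Classical in
/-- The finite set of all divisors of `f ≠ 0`, not only the monic ones. -/
noncomputable def polyDivisors (f : K[X]) : Finset K[X] :=
  (degreeLTFinset K (f.natDegree + 1)).filter (· ∣ f)

theorem mem_polyDivisors {f d : K[X]} (hf : f ≠ 0) : d ∈ polyDivisors f ↔ d ∣ f := by
  classical
  rw [polyDivisors, Finset.mem_filter, and_iff_right_iff_imp, mem_degreeLTFinset]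
  intro hd
  rw [← natDegree_lt_iff_degree_lt (ne_zero_of_dvd_ne_zero hf hd)]
  exact Nat.lt_succ_of_le (natDegree_le_of_dvd hd hf)

theorem card_polyDivisors_le_prod_count [DecidableEq K] {f : K[X]} (hf : f ≠ 0) :
    (polyDivisors f).card ≤ Fintype.card K *
      ∏ p ∈ (normalizedFactors f).toFinset, ((normalizedFactors f).count p + 1) := by
  rw [← Multiset.card_Iic, ← Finset.card_univ, ← Finset.card_product]
  refine Finset.card_le_card_of_injOn (fun d => (d.leadingCoeff, normalizedFactors d))
    (fun d hd => ?_) fun d _ e _ hde => ?_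
  · have hdf := (mem_polyDivisors hf).1 hd
    simpa using (dvd_iff_normalizedFactors_le_normalizedFactors
      (ne_zero_of_dvd_ne_zero hf hdf) hf).1 hdf
  · obtain ⟨hlead, hfactors⟩ := Prod.mk.inj hde
    rw [← leadingCoeff_mul_prod_normalizedFactors d, hlead, hfactors,
      leadingCoeff_mul_prod_normalizedFactors]

theorem prod_count_small_factors_le [DecidableEq K] {f : K[X]} (hf : f ≠ 0) (D : ℕ) :
    ∏ p ∈ (normalizedFactors f).toFinset with p.natDegree ≤ D,
        ((normalizedFactors f).count p + 1) ≤
      (f.natDegree + 1) ^ Fintype.card K ^ (D + 1) := by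
  have hcount : ∀ p ∈ (normalizedFactors f).toFinset,
      (normalizedFactors f).count p ≤ f.natDegree := fun p hp =>
    calc (normalizedFactors f).count p ≤ (normalizedFactors f).count p * p.natDegree :=
          Nat.le_mul_of_pos_right _ (ne_zero_and_natDegree_pos_of_mem_normalizedFactors hp).2
      _ ≤ f.natDegree := by
          rw [← sum_count_normalizedFactors_mul_natDegree hf]
          exact Finset.single_le_sum (f := fun p => (normalizedFactors f).count p * p.natDegree)
            (fun _ _ => Nat.zero_le _) hp
  have hcard : ((normalizedFactors f).toFinset.filter (·.natDegree ≤ D)).card ≤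
      Fintype.card K ^ (D + 1) := by
    rw [← card_degreeLTFinset]
    refine Finset.card_le_card fun p hp => ?_
    obtain ⟨hpf, hpD⟩ := Finset.mem_filter.1 hp
    rw [mem_degreeLTFinset, ← natDegree_lt_iff_degree_lt
      (ne_zero_and_natDegree_pos_of_mem_normalizedFactors hpf).1]
    exact Nat.lt_succ_of_le hpD
  refine (Finset.prod_le_pow_card _ _ (f.natDegree + 1) fun p hp => ?_).trans
    (Nat.pow_le_pow_right (Nat.succ_pos _) hcard)
  exact Nat.succ_le_succ (hcount p (Finset.mem_filter.1 hp).1)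

theorem card_polyDivisors_le {f : K[X]} (hf : f ≠ 0) (D : ℕ) :
    (polyDivisors f).card ≤ Fintype.card K *
      ((f.natDegree + 1) ^ Fintype.card K ^ (D + 1) * 2 ^ (f.natDegree / (D + 1))) := by
  classical
  refine (card_polyDivisors_le_prod_count hf).trans (Nat.mul_le_mul_left _ ?_)
  rw [← Finset.prod_filter_mul_prod_filter_not _ fun p : K[X] => p.natDegree ≤ D]
  exact Nat.mul_le_mul (prod_count_small_factors_le hf D) (prod_count_large_factors_le hf D)

/-- The largest number of divisors of a nonzero polynomial of degree at most `n`. -/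
noncomputable def maxDivisors (K : Type*) [Field K] [Fintype K] (n : ℕ) : ℕ :=
  (nonzeroDegreeLTFinset K (n + 1)).sup fun f => (polyDivisors f).card

theorem card_polyDivisors_le_maxDivisors {f : K[X]} (hf : f ≠ 0) {n : ℕ} (hn : f.natDegree ≤ n) :
    (polyDivisors f).card ≤ maxDivisors K n :=
  Finset.le_sup (f := fun f : K[X] => (polyDivisors f).card)
    (mem_nonzeroDegreeLTFinset.2 ⟨hf, Nat.lt_succ_of_le hn⟩)

variable (K)

theorem maxDivisors_pos (n : ℕ) : 0 < maxDivisors K n :=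
  (Finset.card_pos.2 ⟨1, (mem_polyDivisors one_ne_zero).2 dvd_rfl⟩).trans_le
    (card_polyDivisors_le_maxDivisors one_ne_zero (natDegree_one.trans_le n.zero_le))

theorem maxDivisors_le (n D : ℕ) : maxDivisors K n ≤
    Fintype.card K * ((n + 1) ^ Fintype.card K ^ (D + 1) * 2 ^ (n / (D + 1))) := by
  refine Finset.sup_le fun f hf => ?_
  obtain ⟨hf, hn⟩ := mem_nonzeroDegreeLTFinset.1 hf
  have hn := Nat.le_of_lt_succ hn
  refine (card_polyDivisors_le hf D).trans ?_
  gcongr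
  exact one_le_two

end Divisors

section SmallRatios

variable {K : Type*} [Field K]

theorem exists_degree_lt_dvd_sub_mul {F : K[X]} (hF : F ≠ 0) (t : K[X]) {A C : ℕ}
    (hAC : F.natDegree < A + C) :
    ∃ a c : K[X], (a, c) ≠ 0 ∧ a.degree < A ∧ c.degree < C ∧ F ∣ c - t * a := by
  have hfinite : ∀ n : ℕ, Module.Finite K (degreeLT K n) := fun n =>
    Module.Finite.equiv (degreeLTEquiv K n).symm
  have hfinrank : ∀ n : ℕ, Module.finrank K (degreeLT K n) = n := fun n =>
    (degreeLTEquiv K n).finrank_eq.trans (Module.finrank_fin_fun K)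
  have : Module.Finite K (AdjoinRoot F) := (AdjoinRoot.powerBasis hF).finite
  let residue : degreeLT K A × degreeLT K C →ₗ[K] AdjoinRoot F :=
    (AdjoinRoot.mkₐ F).toLinearMap ∘ₗ
      ((degreeLT K C).subtype ∘ₗ LinearMap.snd K _ _ -
        LinearMap.mulLeft K t ∘ₗ (degreeLT K A).subtype ∘ₗ LinearMap.fst K _ _)
  have hker : LinearMap.ker residue ≠ ⊥ := LinearMap.ker_ne_bot_of_finrank_lt <| by
    rwa [Module.finrank_prod, hfinrank, hfinrank, (AdjoinRoot.powerBasis hF).finrank,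
      AdjoinRoot.powerBasis_dim]
  obtain ⟨⟨a, c⟩, hmem, hne⟩ := Submodule.exists_mem_ne_zero_of_ne_bot hker
  refine ⟨a, c, fun h => hne ?_, mem_degreeLT.1 a.2, mem_degreeLT.1 c.2,
    AdjoinRoot.mk_eq_zero.1 hmem⟩
  exact Prod.ext (Subtype.ext (congrArg Prod.fst h)) (Subtype.ext (congrArg Prod.snd h))

theorem exists_isCoprime_dvd_sub_mul {F t : K[X]} (hF : Irreducible F) (ht : ¬ F ∣ t) {A C : ℕ}
    (hA : A ≤ F.natDegree) (hC : C ≤ F.natDegree) (hAC : F.natDegree < A + C) :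
    ∃ a c : K[X], a ≠ 0 ∧ c ≠ 0 ∧ IsCoprime a c ∧ a.natDegree < A ∧ c.natDegree < C ∧
      F ∣ c - t * a := by
  obtain ⟨a, c, hne, haA, hcC, hdvd⟩ := exists_degree_lt_dvd_sub_mul hF.ne_zero t hAC
  have hsmall : ∀ {f : K[X]} {n : ℕ}, f.degree < n → n ≤ F.natDegree → F ∣ f → f = 0 :=
    fun hf hn h => eq_zero_of_dvd_of_degree_lt h
      (hf.trans_le (by rwa [degree_eq_natDegree hF.ne_zero, Nat.cast_le]))
  have ha : a ≠ 0 := by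
    rintro rfl
    rw [mul_zero, sub_zero] at hdvd
    exact hne (Prod.ext rfl (hsmall hcC hC hdvd))
  have hFa : ¬ F ∣ a := fun h => ha (hsmall haA hA h)
  have hc : c ≠ 0 := by
    rintro rfl
    rw [zero_sub, dvd_neg] at hdvd
    exact (hF.prime.dvd_or_dvd hdvd).elim ht hFa
  obtain ⟨a', c', g, hcop, rfl, rfl⟩ := UniqueFactorizationMonoid.exists_reduced_factors a ha c
  rw [mul_left_comm, ← mul_sub] at hdvd
  exact ⟨a', c', right_ne_zero_of_mul ha, right_ne_zero_of_mul hc, hcop.isCoprime,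
    (natDegree_le_of_dvd (dvd_mul_left a' g) ha).trans_lt ((natDegree_lt_iff_degree_lt ha).2 haA),
    (natDegree_le_of_dvd (dvd_mul_left c' g) hc).trans_lt ((natDegree_lt_iff_degree_lt hc).2 hcC),
    (hF.prime.dvd_or_dvd hdvd).resolve_left fun h => hFa (h.mul_right a')⟩

end SmallRatios

section Parabola

theorem degree_sq_sub_sq_lt {R : Type*} [CommRing R] {u u' : R[X]} {m : ℕ}
    (hu : u.degree < m) (hu' : u'.degree < m) :
    (u ^ 2 - u' ^ 2).degree < (m + m : ℕ) := by
  rw [sq_sub_sq]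
  exact degree_mul_lt_add ((degree_add_le _ _).trans (max_le hu.le hu'.le))
    ((degree_sub_le _ _).trans_lt (max_lt hu hu'))

variable {K : Type*} [Field K]

/-- `IsSmallRatio F t m Z a c` says that `t ≡ c / a` modulo `F` is a reduced fraction whose
numerator and denominator are so small that `a * x - c * y`, with `x` of degree less than `2 * m`
and `y` of degree less than `m`, has degree less than `deg F + Z`. -/
structure IsSmallRatio (F t : K[X]) (m Z : ℕ) (a c : K[X]) : Prop where
  left_ne_zero : a ≠ 0
  right_ne_zero : c ≠ 0
  isCoprime : IsCoprime a c
  isCoprime_modulus : IsCoprime F c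
  dvd_sub_mul : F ∣ c - t * a
  natDegree_left_add_le : a.natDegree + (m + m) ≤ F.natDegree + Z
  natDegree_right_add_le : c.natDegree + m ≤ F.natDegree + Z

/-- The quadratic form `a * u ^ 2 - c * v`, homogeneous when `v` has weight two. When `t ≡ c / a`
modulo `F`, it is constant modulo `F` on the parabola `u ^ 2 ≡ t * v - w`. -/
noncomputable def parabolaForm (a c : K[X]) (p : K[X] × K[X]) : K[X] :=
  a * p.1 ^ 2 - c * p.2

theorem exists_mul_of_parabolaForm_eq {a c : K[X]} (hc : c ≠ 0) (hac : IsCoprime a c)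
    {p p' : K[X] × K[X]} (h : parabolaForm a c p = parabolaForm a c p') :
    ∃ k, p.1 ^ 2 - p'.1 ^ 2 = c * k ∧ p.2 - p'.2 = a * k := by
  have hmul : a * (p.1 ^ 2 - p'.1 ^ 2) = c * (p.2 - p'.2) := by
    unfold parabolaForm at h
    linear_combination h
  obtain ⟨k, hk⟩ := hac.symm.dvd_of_dvd_mul_left (Dvd.intro _ hmul.symm)
  refine ⟨k, hk, mul_left_cancel₀ hc ?_⟩
  rw [← hmul, hk, mul_left_comm]

variable [Fintype K]

open Classical in
/-- The points `(u, v)` of the parabola `u ^ 2 = t * v - w` modulo `F` with coordinates of degree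
less than `m`. -/
noncomputable def parabolaPoints (F t w : K[X]) (m : ℕ) : Finset (K[X] × K[X]) :=
  (degreeLTFinset K m ×ˢ degreeLTFinset K m).filter fun p => F ∣ p.1 ^ 2 - t * p.2 + w

variable {F t w a c : K[X]} {m Z : ℕ} {p p' : K[X] × K[X]}

theorem mem_parabolaPoints : p ∈ parabolaPoints F t w m ↔
    (p.1.degree < m ∧ p.2.degree < m) ∧ F ∣ p.1 ^ 2 - t * p.2 + w := by
  classical
  rw [parabolaPoints, Finset.mem_filter, Finset.mem_product, mem_degreeLTFinset,
    mem_degreeLTFinset]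

namespace IsSmallRatio

theorem dvd_parabolaForm_sub (h : IsSmallRatio F t m Z a c) (hp : p ∈ parabolaPoints F t w m)
    (hp' : p' ∈ parabolaPoints F t w m) : F ∣ parabolaForm a c p - parabolaForm a c p' := by
  have hsub := dvd_sub (mem_parabolaPoints.1 hp).2 (mem_parabolaPoints.1 hp').2
  convert dvd_sub (hsub.mul_left a) (h.dvd_sub_mul.mul_right (p.2 - p'.2)) using 1
  unfold parabolaForm
  ring

theorem degree_parabolaForm_sub_lt (h : IsSmallRatio F t m Z a c)
    (hp : p ∈ parabolaPoints F t w m) (hp' : p' ∈ parabolaPoints F t w m) :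
    (parabolaForm a c p - parabolaForm a c p').degree < (F.natDegree + Z : ℕ) := by
  obtain ⟨⟨hu, hv⟩, -⟩ := mem_parabolaPoints.1 hp
  obtain ⟨⟨hu', hv'⟩, -⟩ := mem_parabolaPoints.1 hp'
  have hform : parabolaForm a c p - parabolaForm a c p' =
      a * (p.1 ^ 2 - p'.1 ^ 2) - c * (p.2 - p'.2) := by
    unfold parabolaForm
    ring
  rw [hform]
  refine (degree_sub_le _ _).trans_lt (max_lt ?_ ?_)
  · exact (degree_mul_lt_add degree_le_natDegree (degree_sq_sub_sq_lt hu hu')).trans_le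
      (Nat.cast_le.2 h.natDegree_left_add_le)
  · exact (degree_mul_lt_add degree_le_natDegree
      ((degree_sub_le _ _).trans_lt (max_lt hv hv'))).trans_le
      (Nat.cast_le.2 h.natDegree_right_add_le)

theorem card_image_parabolaForm_le [DecidableEq K] (hF : Irreducible F)
    (h : IsSmallRatio F t m Z a c) {W : Finset (K[X] × K[X])} (hW : W ⊆ parabolaPoints F t w m)
    {d : K[X]} (hFd : IsCoprime F d) (hd : ∀ p ∈ W, d ∣ parabolaForm a c p) :
    (W.image (parabolaForm a c)).card ≤ Fintype.card K ^ (Z - d.natDegree) := by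
  have hd0 : d ≠ 0 := by
    rintro rfl
    exact hF.not_isUnit (isCoprime_zero_right.1 hFd)
  convert card_le_of_dvd_sub (W := W.image (parabolaForm a c)) (n := F.natDegree + Z)
    (mul_ne_zero hF.ne_zero hd0) ?_ ?_ using 2
  · rw [natDegree_mul hF.ne_zero hd0, Nat.add_sub_add_left]
  · simp only [Finset.forall_mem_image]
    exact fun p hp p' hp' => hFd.mul_dvd (h.dvd_parabolaForm_sub (hW hp) (hW hp'))
      (dvd_sub (hd p hp) (hd p' hp'))
  · simp only [Finset.forall_mem_image]
    exact fun p hp p' hp' => h.degree_parabolaForm_sub_lt (hW hp) (hW hp')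

theorem card_parabolaPoints_le_of_le_natDegree (hF : Irreducible F)
    (h : IsSmallRatio F t m Z a c) (hdeg : m ≤ a.natDegree ∨ 2 * m ≤ c.natDegree) :
    (parabolaPoints F t w m).card ≤ 2 * Fintype.card K ^ Z := by
  classical
  have heq : ∀ p ∈ parabolaPoints F t w m, ∀ p' ∈ parabolaPoints F t w m,
      parabolaForm a c p = parabolaForm a c p' → p ∈ ({p', (-p'.1, p'.2)} : Finset _) := by
    intro p hp p' hp' hform
    obtain ⟨⟨hu, hv⟩, -⟩ := mem_parabolaPoints.1 hp
    obtain ⟨⟨hu', hv'⟩, -⟩ := mem_parabolaPoints.1 hp'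
    obtain ⟨k, hsq, hlin⟩ := exists_mul_of_parabolaForm_eq h.right_ne_zero h.isCoprime hform
    have hk : k = 0 := by
      rw [← degree_eq_bot, ← Nat.WithBot.lt_zero_iff]
      rcases hdeg with ha | hc
      · have hlt := (degree_sub_le _ _).trans_lt (max_lt hv hv')
        rw [hlin] at hlt
        simpa only [Nat.sub_eq_zero_of_le ha, Nat.cast_zero] using
          degree_lt_sub_of_degree_mul_lt h.left_ne_zero hlt
      · have hlt := degree_sq_sub_sq_lt hu hu'
        rw [hsq, ← two_mul] at hlt
        simpa only [Nat.sub_eq_zero_of_le hc, Nat.cast_zero] using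
          degree_lt_sub_of_degree_mul_lt h.right_ne_zero hlt
    rw [hk, mul_zero, sub_eq_zero] at hsq hlin
    rw [Finset.mem_insert, Finset.mem_singleton]
    exact (sq_eq_sq_iff_eq_or_eq_neg.1 hsq).imp (Prod.ext · hlin) (Prod.ext · hlin)
  calc (parabolaPoints F t w m).card
      ≤ 2 * ((parabolaPoints F t w m).image (parabolaForm a c)).card := by
        refine Finset.card_le_mul_card_image _ 2 ?_
        simp only [Finset.forall_mem_image]
        intro p' hp'
        refine (Finset.card_le_card (t := {p', (-p'.1, p'.2)}) fun p hp => ?_).trans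
          Finset.card_le_two
        exact heq p (Finset.mem_filter.1 hp).1 p' hp' (Finset.mem_filter.1 hp).2
    _ ≤ 2 * Fintype.card K ^ Z := by
        gcongr
        simpa only [natDegree_one, Nat.sub_zero] using
          h.card_image_parabolaForm_le hF subset_rfl isCoprime_one_right fun p _ => one_dvd _

end IsSmallRatio

end Parabola

section FactorClasses

theorem degree_lt_half_of_degree_mul_lt {R : Type*} [Semiring R] [NoZeroDivisors R] {f g : R[X]}
    {n : ℕ} (h : (f * g).degree < n) (hfg : f.degree ≤ g.degree) :
    f.degree < ((n + 1) / 2 : ℕ) := by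
  rcases eq_or_ne f 0 with rfl | hf
  · rw [degree_zero]
    exact WithBot.bot_lt_coe _
  have hg : g ≠ 0 := by
    rintro rfl
    exact hf (degree_eq_bot.1 (le_bot_iff.1 hfg))
  rw [← natDegree_lt_iff_degree_lt (mul_ne_zero hf hg), natDegree_mul hf hg] at h
  rw [← natDegree_lt_iff_degree_lt hf]
  have := natDegree_le_natDegree hfg
  omega

theorem isUnit_two_of_two_ne_zero {K : Type*} [Field K] (h2 : (2 : K) ≠ 0) :
    IsUnit (2 : K[X]) := by
  simpa only [map_ofNat] using (IsUnit.mk0 (2 : K) h2).map C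

theorem natDegree_gcd_add_natDegree_lcm {K : Type*} [Field K] [DecidableEq K] {d e : K[X]}
    (hde : d * e ≠ 0) :
    (EuclideanDomain.gcd d e).natDegree + (EuclideanDomain.lcm d e).natDegree =
      (d * e).natDegree := by
  rw [← EuclideanDomain.gcd_mul_lcm d e] at hde ⊢
  exact (natDegree_mul (left_ne_zero_of_mul hde) (right_ne_zero_of_mul hde)).symm

variable {K : Type*} [Field K] [Fintype K] {F t w a c d e : K[X]} {m Z : ℕ}

theorem card_le_of_dvd_sub_of_dvd_add [DecidableEq K] {W : Finset K[X]} {b : K[X]} {n : ℕ}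
    (hd : d ≠ 0) (he : e ≠ 0) (hsub : ∀ u ∈ W, d ∣ u - b) (hadd : ∀ u ∈ W, e ∣ u + b)
    (hsq : ∀ u ∈ W, (u ^ 2 - b ^ 2).degree < n) :
    W.card ≤ 2 * Fintype.card K ^ ((n + 1) / 2 - (EuclideanDomain.lcm d e).natDegree) := by
  have hlcm : EuclideanDomain.lcm d e ≠ 0 := fun h =>
    (EuclideanDomain.lcm_eq_zero_iff.1 h).elim hd he
  have hdvd : ∀ u ∈ W, ∀ u' ∈ W, EuclideanDomain.lcm d e ∣ u - u' := fun u hu u' hu' =>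
    EuclideanDomain.lcm_dvd (by simpa using dvd_sub (hsub u hu) (hsub u' hu'))
      (by simpa using dvd_sub (hadd u hu) (hadd u' hu'))
  -- One of `u - b`, `u + b` has less than half the degree of `u ^ 2 - b ^ 2`.
  have hclose : ∀ V ⊆ W, ∀ b', (∀ u ∈ V, (u - b').degree < ((n + 1) / 2 : ℕ)) →
      V.card ≤ Fintype.card K ^ ((n + 1) / 2 - (EuclideanDomain.lcm d e).natDegree) := by
    refine fun V hVW b' hV => card_le_of_dvd_sub hlcm
      (fun u hu u' hu' => hdvd u (hVW hu) u' (hVW hu')) fun u hu u' hu' => ?_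
    rw [← sub_sub_sub_cancel_right u u' b']
    exact (degree_sub_le _ _).trans_lt (max_lt (hV u hu) (hV u' hu'))
  rw [← Finset.card_filter_add_card_filter_not fun u => (u - b).degree ≤ (u + b).degree, two_mul]
  refine add_le_add (hclose _ (Finset.filter_subset _ _) b fun u hu => ?_)
    (hclose _ (Finset.filter_subset _ _) (-b) fun u hu => ?_)
  · obtain ⟨huW, hle⟩ := Finset.mem_filter.1 hu
    exact degree_lt_half_of_degree_mul_lt (by rw [mul_comm, ← sq_sub_sq]; exact hsq u huW) hle
  · obtain ⟨huW, hlt⟩ := Finset.mem_filter.1 hu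
    rw [sub_neg_eq_add]
    exact degree_lt_half_of_degree_mul_lt (by rw [← sq_sub_sq]; exact hsq u huW) (not_le.1 hlt).le

/-- A point of `parabolaPoints F t w m` chosen in each fibre of `parabolaForm a c`; it depends only
on the value `y` of the form, and is junk if the fibre is empty. -/
noncomputable def fiberPoint (F t w a c : K[X]) (m : ℕ) (y : K[X]) : K[X] × K[X] :=
  Function.invFunOn (parabolaForm a c) (parabolaPoints F t w m) y

open Classical in
/-- For `c = d * e`, the points `(u, v)` for which the factorisation `c = d * e` splits
`c ∣ (u - b) * (u + b)`, where `b` is the first coordinate of the chosen point in the fibre of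
`(u, v)`. -/
noncomputable def factorClass (F t w a c : K[X]) (m : ℕ) (d e : K[X]) : Finset (K[X] × K[X]) :=
  (parabolaPoints F t w m).filter fun p =>
    d ∣ p.1 - (fiberPoint F t w a c m (parabolaForm a c p)).1 ∧
      e ∣ p.1 + (fiberPoint F t w a c m (parabolaForm a c p)).1

theorem fiberPoint_mem {p : K[X] × K[X]} (hp : p ∈ parabolaPoints F t w m) :
    fiberPoint F t w a c m (parabolaForm a c p) ∈ parabolaPoints F t w m :=
  Function.invFunOn_mem ⟨p, hp, rfl⟩

theorem parabolaForm_fiberPoint {p : K[X] × K[X]} (hp : p ∈ parabolaPoints F t w m) :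
    parabolaForm a c (fiberPoint F t w a c m (parabolaForm a c p)) = parabolaForm a c p :=
  Function.invFunOn_eq ⟨p, hp, rfl⟩

theorem mem_factorClass {p : K[X] × K[X]} : p ∈ factorClass F t w a c m d e ↔
    p ∈ parabolaPoints F t w m ∧
      d ∣ p.1 - (fiberPoint F t w a c m (parabolaForm a c p)).1 ∧
        e ∣ p.1 + (fiberPoint F t w a c m (parabolaForm a c p)).1 := by
  classical
  rw [factorClass, Finset.mem_filter]

theorem sq_dvd_parabolaForm_of_mem_factorClass (h2 : (2 : K) ≠ 0) {s : K[X]} (hsd : s ∣ d)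
    (hse : s ∣ e) {p : K[X] × K[X]} (hp : p ∈ factorClass F t w a (d * e) m d e) :
    s ^ 2 ∣ parabolaForm a (d * e) p := by
  obtain ⟨hp, hsub, hadd⟩ := mem_factorClass.1 hp
  have hs : s ∣ (fiberPoint F t w a (d * e) m (parabolaForm a (d * e) p)).1 := by
    have h := dvd_sub (hse.trans hadd) (hsd.trans hsub)
    rw [add_sub_sub_cancel, ← two_mul] at h
    exact (isUnit_two_of_two_ne_zero h2).dvd_mul_left.1 h
  rw [← parabolaForm_fiberPoint hp, parabolaForm]
  refine dvd_sub ((pow_dvd_pow_of_dvd hs 2).mul_left a) (Dvd.dvd.mul_right ?_ _)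
  rw [sq]
  exact mul_dvd_mul hsd hse

namespace IsSmallRatio

theorem card_factorClass_fiber_le [DecidableEq K] (h : IsSmallRatio F t m Z a (d * e))
    (y : K[X]) :
    ((factorClass F t w a (d * e) m d e).filter (parabolaForm a (d * e) · = y)).card ≤
      2 * Fintype.card K ^ (((d * e).natDegree + (m - a.natDegree) + 1) / 2 -
        (EuclideanDomain.lcm d e).natDegree) := by
  set fiber := (factorClass F t w a (d * e) m d e).filter (parabolaForm a (d * e) · = y)
  have hfiber : ∀ p ∈ fiber, p ∈ factorClass F t w a (d * e) m d e ∧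
      parabolaForm a (d * e) p = y := fun p hp => Finset.mem_filter.1 hp
  have hfst : Set.InjOn Prod.fst (fiber : Set (K[X] × K[X])) := by
    intro p hp p' hp' hpp'
    obtain ⟨k, hsq, hlin⟩ := exists_mul_of_parabolaForm_eq h.right_ne_zero h.isCoprime
      ((hfiber p hp).2.trans (hfiber p' hp').2.symm)
    rw [hpp', sub_self, eq_comm, mul_eq_zero_iff_left h.right_ne_zero] at hsq
    rw [hsq, mul_zero, sub_eq_zero] at hlin
    exact Prod.ext hpp' hlin
  have hsq : ∀ p ∈ fiber, (p.1 ^ 2 - (fiberPoint F t w a (d * e) m y).1 ^ 2).degree <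
      ((d * e).natDegree + (m - a.natDegree) : ℕ) := by
    intro p hp
    have hpP := (mem_factorClass.1 (hfiber p hp).1).1
    have hb := fiberPoint_mem (a := a) (c := d * e) hpP
    obtain ⟨k, hsq, hlin⟩ := exists_mul_of_parabolaForm_eq h.right_ne_zero h.isCoprime
      (parabolaForm_fiberPoint (a := a) (c := d * e) hpP).symm
    rw [(hfiber p hp).2] at hb hsq hlin
    have hv := (degree_sub_le _ _).trans_lt
      (max_lt (mem_parabolaPoints.1 hpP).1.2 (mem_parabolaPoints.1 hb).1.2)
    rw [hlin] at hv
    rw [hsq]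
    exact degree_mul_lt_add degree_le_natDegree (degree_lt_sub_of_degree_mul_lt h.left_ne_zero hv)
  rw [← Finset.card_image_of_injOn hfst]
  refine card_le_of_dvd_sub_of_dvd_add (left_ne_zero_of_mul h.right_ne_zero)
    (right_ne_zero_of_mul h.right_ne_zero) (Finset.forall_mem_image.2 fun p hp => ?_)
    (Finset.forall_mem_image.2 fun p hp => ?_) (Finset.forall_mem_image.2 hsq)
  · rw [← (hfiber p hp).2]
    exact (mem_factorClass.1 (hfiber p hp).1).2.1
  · rw [← (hfiber p hp).2]
    exact (mem_factorClass.1 (hfiber p hp).1).2.2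

theorem card_factorClass_le [DecidableEq K] (hF : Irreducible F) (h2 : (2 : K) ≠ 0)
    (h : IsSmallRatio F t m Z a (d * e)) :
    (factorClass F t w a (d * e) m d e).card ≤
      2 * Fintype.card K ^ (((d * e).natDegree + (m - a.natDegree) + 1) / 2 -
        (EuclideanDomain.lcm d e).natDegree) *
        Fintype.card K ^ (Z - 2 * (EuclideanDomain.gcd d e).natDegree) := by
  have hFs : IsCoprime F (EuclideanDomain.gcd d e ^ 2) :=
    (h.isCoprime_modulus.of_isCoprime_of_dvd_right
      ((EuclideanDomain.gcd_dvd_left d e).mul_right e)).pow_right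
  refine (Finset.card_le_mul_card_image _ _ fun y _ => h.card_factorClass_fiber_le y).trans
    (Nat.mul_le_mul_left _ ?_)
  rw [← natDegree_pow]
  exact h.card_image_parabolaForm_le hF (fun p hp => (mem_factorClass.1 hp).1) hFs fun p hp =>
    sq_dvd_parabolaForm_of_mem_factorClass h2 (EuclideanDomain.gcd_dvd_left d e)
      (EuclideanDomain.gcd_dvd_right d e) hp

theorem card_factorClass_sq_le [DecidableEq K] (hF : Irreducible F) (h2 : (2 : K) ≠ 0)
    (h : IsSmallRatio F t m Z a (d * e)) (hZ : Z ≤ m) (ha : a.natDegree < m)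
    (hde : (d * e).natDegree < 2 * m) :
    ((factorClass F t w a (d * e) m d e).card : ℝ) ^ 2 ≤
      4 * ((Fintype.card K : ℝ) ^ (2 * Z) + (Fintype.card K : ℝ) ^ (Z + 2 * m + 1) *
        ((Fintype.card K : ℝ) ^ (EuclideanDomain.gcd d e).natDegree /
          ((Fintype.card K : ℝ) ^ a.natDegree * (Fintype.card K : ℝ) ^ (d * e).natDegree))) := by
  have hq : (1 : ℝ) ≤ Fintype.card K := by exact_mod_cast Fintype.card_pos
  have hq0 : (0 : ℝ) < Fintype.card K := one_pos.trans_le hq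
  have hgcd_lcm := natDegree_gcd_add_natDegree_lcm h.right_ne_zero
  have hgcd : (EuclideanDomain.gcd d e).natDegree * 2 ≤ (d * e).natDegree := by
    rw [mul_comm, ← natDegree_pow, sq]
    exact natDegree_le_of_dvd (mul_dvd_mul (EuclideanDomain.gcd_dvd_left d e)
      (EuclideanDomain.gcd_dvd_right d e)) h.right_ne_zero
  have hcard : ((factorClass F t w a (d * e) m d e).card : ℝ) ≤ _ :=
    Nat.cast_le.2 (h.card_factorClass_le hF h2)
  push_cast at hcard
  generalize (EuclideanDomain.gcd d e).natDegree = σ at *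
  generalize (EuclideanDomain.lcm d e).natDegree = l at *
  generalize (d * e).natDegree = γ at *
  generalize a.natDegree = α at *
  generalize (Fintype.card K : ℝ) = q at *
  set j := (γ + (m - α) + 1) / 2 - l with hj
  calc ((factorClass F t w a (d * e) m d e).card : ℝ) ^ 2
      ≤ (2 * q ^ j * q ^ (Z - 2 * σ)) ^ 2 := by gcongr
    _ = 4 * q ^ (2 * (j + (Z - 2 * σ))) := by ring
    _ ≤ 4 * (q ^ (2 * Z) + q ^ (Z + 2 * m + 1) * (q ^ σ / (q ^ α * q ^ γ))) := by
        refine mul_le_mul_of_nonneg_left ?_ (by norm_num)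
        rcases Nat.eq_zero_or_pos j with hj0 | hj0
        · refine le_add_of_le_of_nonneg (pow_le_pow_right₀ hq (by omega)) (by positivity)
        · refine le_add_of_nonneg_of_le (by positivity) ?_
          rw [mul_div_assoc', le_div_iff₀ (by positivity), ← pow_add, ← pow_add, ← pow_add]
          exact pow_le_pow_right₀ hq (by omega)

end IsSmallRatio

end FactorClasses

section Covering

variable {K : Type*} [Field K] [Fintype K] {F t w a c : K[X]} {m Z : ℕ}

open Classical in
/-- The weight with which the reduced fraction `c / a` contributes to the count of points on a
parabola. -/
noncomputable def fractionWeight (a c : K[X]) : ℝ :=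
  ∑ s ∈ polyDivisors c with s ^ 2 ∣ c, (Fintype.card K : ℝ) ^ s.natDegree /
    ((Fintype.card K : ℝ) ^ a.natDegree * (Fintype.card K : ℝ) ^ c.natDegree)

theorem fractionWeight_nonneg (a c : K[X]) : 0 ≤ fractionWeight a c :=
  Finset.sum_nonneg fun _ _ => by positivity

theorem le_fractionWeight (hc : c ≠ 0) {s : K[X]} (hs : s ^ 2 ∣ c) :
    (Fintype.card K : ℝ) ^ s.natDegree /
      ((Fintype.card K : ℝ) ^ a.natDegree * (Fintype.card K : ℝ) ^ c.natDegree) ≤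
        fractionWeight a c := by
  classical
  refine Finset.single_le_sum (f := fun s : K[X] => (Fintype.card K : ℝ) ^ s.natDegree /
    ((Fintype.card K : ℝ) ^ a.natDegree * (Fintype.card K : ℝ) ^ c.natDegree))
    (fun _ _ => by positivity) (Finset.mem_filter.2 ⟨(mem_polyDivisors hc).2 ?_, hs⟩)
  exact (dvd_pow_self s two_ne_zero).trans hs

namespace IsSmallRatio

theorem exists_mem_factorClass (h : IsSmallRatio F t m Z a c) {p : K[X] × K[X]}
    (hp : p ∈ parabolaPoints F t w m) :
    ∃ d ∈ polyDivisors c, p ∈ factorClass F t w a c m d (c / d) := by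
  obtain ⟨k, hsq, -⟩ := exists_mul_of_parabolaForm_eq h.right_ne_zero h.isCoprime
    (parabolaForm_fiberPoint (a := a) (c := c) hp).symm
  rw [sq_sub_sq, mul_comm] at hsq
  obtain ⟨d, e, hd, he, hde⟩ := exists_dvd_and_dvd_of_dvd_mul (Dvd.intro k hsq.symm)
  have hd0 : d ≠ 0 := left_ne_zero_of_mul (hde ▸ h.right_ne_zero)
  have hdiv : c / d = e := by rw [hde, mul_div_cancel_left₀ e hd0]
  exact ⟨d, (mem_polyDivisors h.right_ne_zero).2 ⟨e, hde⟩,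
    mem_factorClass.2 ⟨hp, hd, hdiv ▸ he⟩⟩

theorem card_parabolaPoints_sq_le_of_natDegree_lt (hF : Irreducible F) (h2 : (2 : K) ≠ 0)
    (h : IsSmallRatio F t m Z a c) (hZ : Z ≤ m) (ha : a.natDegree < m)
    (hc : c.natDegree < 2 * m) :
    ((parabolaPoints F t w m).card : ℝ) ^ 2 ≤ (maxDivisors K (2 * m) : ℝ) ^ 2 *
      (4 * ((Fintype.card K : ℝ) ^ (2 * Z) +
        (Fintype.card K : ℝ) ^ (Z + 2 * m + 1) * fractionWeight a c)) := by
  classical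
  have hcover : (parabolaPoints F t w m).card ≤
      ∑ d ∈ polyDivisors c, (factorClass F t w a c m d (c / d)).card :=
    (Finset.card_le_card fun p hp => Finset.mem_biUnion.2 (h.exists_mem_factorClass hp)).trans
      Finset.card_biUnion_le
  have hclass : ∀ d ∈ polyDivisors c,
      ((factorClass F t w a c m d (c / d)).card : ℝ) ^ 2 ≤
        4 * ((Fintype.card K : ℝ) ^ (2 * Z) +
          (Fintype.card K : ℝ) ^ (Z + 2 * m + 1) * fractionWeight a c) := by
    intro d hd
    have hd := (mem_polyDivisors h.right_ne_zero).1 hd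
    have hde : d * (c / d) = c :=
      EuclideanDomain.mul_div_cancel' (ne_zero_of_dvd_ne_zero h.right_ne_zero hd) hd
    generalize c / d = e at hde
    subst hde
    refine (h.card_factorClass_sq_le hF h2 hZ ha hc).trans ?_
    gcongr
    refine le_fractionWeight h.right_ne_zero ?_
    rw [sq]
    exact mul_dvd_mul (EuclideanDomain.gcd_dvd_left _ _) (EuclideanDomain.gcd_dvd_right _ _)
  calc ((parabolaPoints F t w m).card : ℝ) ^ 2
      ≤ (∑ d ∈ polyDivisors c, ((factorClass F t w a c m d (c / d)).card : ℝ)) ^ 2 := by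
        gcongr
        exact_mod_cast hcover
    _ ≤ (polyDivisors c).card *
          ∑ d ∈ polyDivisors c, ((factorClass F t w a c m d (c / d)).card : ℝ) ^ 2 :=
        sq_sum_le_card_mul_sum_sq
    _ ≤ (polyDivisors c).card * ((polyDivisors c).card * (4 * ((Fintype.card K : ℝ) ^ (2 * Z) +
          (Fintype.card K : ℝ) ^ (Z + 2 * m + 1) * fractionWeight a c))) := by
        gcongr
        rw [← nsmul_eq_mul]
        exact Finset.sum_le_card_nsmul _ _ _ hclass
    _ ≤ _ := by
        have := fractionWeight_nonneg a c
        rw [← mul_assoc, ← sq]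
        gcongr
        exact card_polyDivisors_le_maxDivisors h.right_ne_zero hc.le

open Classical in
theorem card_parabolaPoints_sq_le (hF : Irreducible F) (h2 : (2 : K) ≠ 0)
    (h : IsSmallRatio F t m Z a c) (hZ : Z ≤ m) :
    ((parabolaPoints F t w m).card : ℝ) ^ 2 ≤
      (2 * maxDivisors K (2 * m) * (Fintype.card K : ℝ) ^ Z) ^ 2 +
        4 * (maxDivisors K (2 * m) : ℝ) ^ 2 * (Fintype.card K : ℝ) ^ (Z + 2 * m + 1) *
          ∑ x ∈ nonzeroDegreeLTFinset K m ×ˢ nonzeroDegreeLTFinset K (2 * m) with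
            F ∣ x.2 - t * x.1, fractionWeight x.1 x.2 := by
  have hsum : 0 ≤ ∑ x ∈ nonzeroDegreeLTFinset K m ×ˢ nonzeroDegreeLTFinset K (2 * m) with
      F ∣ x.2 - t * x.1, fractionWeight x.1 x.2 :=
    Finset.sum_nonneg fun _ _ => fractionWeight_nonneg _ _
  by_cases hdeg : a.natDegree < m ∧ c.natDegree < 2 * m
  · refine (h.card_parabolaPoints_sq_le_of_natDegree_lt hF h2 hZ hdeg.1 hdeg.2).trans ?_
    have hac : (a, c) ∈ (nonzeroDegreeLTFinset K m ×ˢ nonzeroDegreeLTFinset K (2 * m)).filter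
        fun x => F ∣ x.2 - t * x.1 := by
      rw [Finset.mem_filter, Finset.mem_product, mem_nonzeroDegreeLTFinset,
        mem_nonzeroDegreeLTFinset]
      exact ⟨⟨⟨h.left_ne_zero, hdeg.1⟩, h.right_ne_zero, hdeg.2⟩, h.dvd_sub_mul⟩
    have hweight := Finset.single_le_sum (f := fun x : K[X] × K[X] => fractionWeight x.1 x.2)
      (fun _ _ => fractionWeight_nonneg _ _) hac
    calc _ = (2 * maxDivisors K (2 * m) * (Fintype.card K : ℝ) ^ Z) ^ 2 +
            4 * (maxDivisors K (2 * m) : ℝ) ^ 2 * (Fintype.card K : ℝ) ^ (Z + 2 * m + 1) *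
              fractionWeight a c := by ring
      _ ≤ _ := by gcongr
  · rw [not_and_or, not_lt, not_lt] at hdeg
    refine le_add_of_le_of_nonneg (pow_le_pow_left₀ (Nat.cast_nonneg _) ?_ 2) (by positivity)
    have hcard := (h.card_parabolaPoints_le_of_le_natDegree (w := w) hF hdeg).trans
      (Nat.mul_le_mul_right _ (Nat.le_mul_of_pos_right 2 (maxDivisors_pos K (2 * m))))
    exact_mod_cast hcard

end IsSmallRatio

variable (K)

open Classical in
theorem sum_inv_card_pow_natDegree_dvd_le {f : K[X]} (hf : f ≠ 0) (n : ℕ) :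
    ∑ c ∈ nonzeroDegreeLTFinset K n with f ∣ c, ((Fintype.card K : ℝ) ^ c.natDegree)⁻¹ ≤
      ((Fintype.card K : ℝ) ^ f.natDegree)⁻¹ * (Fintype.card K * n) := by
  have hsub : (nonzeroDegreeLTFinset K n).filter (f ∣ ·) ⊆
      (nonzeroDegreeLTFinset K n).image (f * ·) := by
    intro c hc
    obtain ⟨hc, e, rfl⟩ := Finset.mem_filter.1 hc
    obtain ⟨hfe, hn⟩ := mem_nonzeroDegreeLTFinset.1 hc
    refine Finset.mem_image_of_mem _ (mem_nonzeroDegreeLTFinset.2 ⟨right_ne_zero_of_mul hfe, ?_⟩)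
    exact (natDegree_le_of_dvd (dvd_mul_left e f) hfe).trans_lt hn
  calc ∑ c ∈ nonzeroDegreeLTFinset K n with f ∣ c, ((Fintype.card K : ℝ) ^ c.natDegree)⁻¹
      ≤ ∑ c ∈ (nonzeroDegreeLTFinset K n).image (f * ·),
          ((Fintype.card K : ℝ) ^ c.natDegree)⁻¹ :=
        Finset.sum_le_sum_of_subset_of_nonneg hsub fun _ _ _ => by positivity
    _ = ∑ e ∈ nonzeroDegreeLTFinset K n, ((Fintype.card K : ℝ) ^ f.natDegree)⁻¹ *
          ((Fintype.card K : ℝ) ^ e.natDegree)⁻¹ := by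
        rw [Finset.sum_image fun x _ y _ hxy => mul_left_cancel₀ hf hxy]
        refine Finset.sum_congr rfl fun e he => ?_
        rw [natDegree_mul hf (mem_nonzeroDegreeLTFinset.1 he).1, pow_add, mul_inv]
    _ ≤ ((Fintype.card K : ℝ) ^ f.natDegree)⁻¹ * (Fintype.card K * n) := by
        rw [← Finset.mul_sum]
        gcongr
        exact sum_inv_card_pow_natDegree_le n

open Classical in
theorem sum_card_pow_natDegree_sq_dvd_le (n : ℕ) :
    ∑ c ∈ nonzeroDegreeLTFinset K n, ∑ s ∈ polyDivisors c with s ^ 2 ∣ c,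
        (Fintype.card K : ℝ) ^ s.natDegree * ((Fintype.card K : ℝ) ^ c.natDegree)⁻¹ ≤
      (Fintype.card K * n) ^ 2 := by
  have hswap : ∀ c s : K[X],
      (c ∈ nonzeroDegreeLTFinset K n ∧ s ∈ (polyDivisors c).filter (· ^ 2 ∣ c)) ↔
        (c ∈ (nonzeroDegreeLTFinset K n).filter (s ^ 2 ∣ ·) ∧ s ∈ nonzeroDegreeLTFinset K n) := by
    intro c s
    simp only [Finset.mem_filter]
    constructor
    · rintro ⟨hc, -, hsc⟩
      obtain ⟨hc0, hn⟩ := mem_nonzeroDegreeLTFinset.1 hc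
      have hsc' := (dvd_pow_self s two_ne_zero).trans hsc
      exact ⟨⟨hc, hsc⟩, mem_nonzeroDegreeLTFinset.2
        ⟨ne_zero_of_dvd_ne_zero hc0 hsc', (natDegree_le_of_dvd hsc' hc0).trans_lt hn⟩⟩
    · rintro ⟨⟨hc, hsc⟩, -⟩
      exact ⟨hc, (mem_polyDivisors (mem_nonzeroDegreeLTFinset.1 hc).1).2
        ((dvd_pow_self s two_ne_zero).trans hsc), hsc⟩
  rw [Finset.sum_comm' hswap]
  calc _ = ∑ s ∈ nonzeroDegreeLTFinset K n, (Fintype.card K : ℝ) ^ s.natDegree *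
          ∑ c ∈ nonzeroDegreeLTFinset K n with s ^ 2 ∣ c,
            ((Fintype.card K : ℝ) ^ c.natDegree)⁻¹ := by simp only [Finset.mul_sum]
    _ ≤ ∑ s ∈ nonzeroDegreeLTFinset K n, (Fintype.card K : ℝ) ^ s.natDegree *
          (((Fintype.card K : ℝ) ^ (s ^ 2).natDegree)⁻¹ * (Fintype.card K * n)) := by
        gcongr with s hs
        exact sum_inv_card_pow_natDegree_dvd_le K
          (pow_ne_zero 2 (mem_nonzeroDegreeLTFinset.1 hs).1) n
    _ = (∑ s ∈ nonzeroDegreeLTFinset K n, ((Fintype.card K : ℝ) ^ s.natDegree)⁻¹) *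
          (Fintype.card K * n) := by
        rw [Finset.sum_mul]
        refine Finset.sum_congr rfl fun s _ => ?_
        rw [natDegree_pow, mul_comm 2, pow_mul]
        field_simp
    _ ≤ (Fintype.card K * n) ^ 2 := by
        rw [sq]
        gcongr
        exact sum_inv_card_pow_natDegree_le n

theorem sum_fractionWeight_le (k n : ℕ) :
    ∑ a ∈ nonzeroDegreeLTFinset K k, ∑ c ∈ nonzeroDegreeLTFinset K n, fractionWeight a c ≤
      Fintype.card K * k * (Fintype.card K * n) ^ 2 := by
  classical
  calc _ = (∑ a ∈ nonzeroDegreeLTFinset K k, ((Fintype.card K : ℝ) ^ a.natDegree)⁻¹) *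
          ∑ c ∈ nonzeroDegreeLTFinset K n, ∑ s ∈ polyDivisors c with s ^ 2 ∣ c,
            (Fintype.card K : ℝ) ^ s.natDegree * ((Fintype.card K : ℝ) ^ c.natDegree)⁻¹ := by
        rw [Finset.sum_mul_sum]
        simp only [Finset.mul_sum, fractionWeight]
        refine Finset.sum_congr rfl fun a _ => Finset.sum_congr rfl fun c _ =>
          Finset.sum_congr rfl fun s _ => ?_
        rw [div_eq_mul_inv, mul_inv, mul_left_comm]
    _ ≤ _ := by
        gcongr
        · exact sum_inv_card_pow_natDegree_le k
        · exact sum_card_pow_natDegree_sq_dvd_le K n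

end Covering

section Energy

variable {K : Type*} [Field K]

theorem dvd_mod_sub (F x : K[X]) : F ∣ x % F - x :=
  ⟨-(x / F), by linear_combination EuclideanDomain.div_add_mod x F⟩

theorem eq_of_dvd_sub_of_degree_lt {F x y : K[X]} (hF : F ≠ 0) (hx : x.degree < F.natDegree)
    (hy : y.degree < F.natDegree) (h : F ∣ x - y) : x = y := by
  rw [← degree_eq_natDegree hF] at hx hy
  exact sub_eq_zero.1 (eq_zero_of_dvd_of_degree_lt h ((degree_sub_le _ _).trans_lt (max_lt hx hy)))

theorem eq_or_eq_neg_of_dvd_sq_sub_sq {F x y : K[X]} (hF : Irreducible F)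
    (hx : x.degree < F.natDegree) (hy : y.degree < F.natDegree) (h : F ∣ x ^ 2 - y ^ 2) :
    x = y ∨ x = -y := by
  rw [sq_sub_sq, hF.prime.dvd_mul] at h
  refine h.symm.imp (eq_of_dvd_sub_of_degree_lt hF.ne_zero hx hy) fun h => ?_
  exact eq_of_dvd_sub_of_degree_lt hF.ne_zero hx (by rwa [degree_neg]) (by rwa [sub_neg_eq_add])

theorem not_dvd_two_mul_sq {F l : K[X]} (hF : Irreducible F) (h2 : (2 : K) ≠ 0)
    (hl : l.degree < F.natDegree) (hl0 : l ≠ 0) : ¬ F ∣ 2 * l ^ 2 := by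
  rw [(isUnit_two_of_two_ne_zero h2).dvd_mul_left]
  rw [← degree_eq_natDegree hF.ne_zero] at hl
  exact fun h => hl0 (eq_zero_of_dvd_of_degree_lt (hF.prime.dvd_of_dvd_pow h) hl)

theorem exists_isSmallRatio {F t : K[X]} (hF : Irreducible F) (ht : ¬ F ∣ t) {m : ℕ}
    (hm : m ≤ F.natDegree) :
    ∃ a c, IsSmallRatio F t m ((3 * m + 1 - F.natDegree) / 2) a c := by
  have hr := hF.natDegree_pos
  obtain ⟨a, c, ha, hc, hac, haA, hcC, hdvd⟩ := exists_isCoprime_dvd_sub_mul hF ht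
    (A := (F.natDegree + 2 - m) / 2) (C := min ((F.natDegree + 2 - m) / 2 + m) F.natDegree)
    (by omega) (by omega) (by omega)
  exact ⟨a, c, ha, hc, hac,
    (hF.coprime_iff_not_dvd).2 fun h => by have := natDegree_le_of_dvd h hc; omega,
    hdvd, by omega, by omega⟩

variable [Fintype K]

open Classical in
/-- The residues modulo `F` whose square has a residue of degree less than `m`. -/
noncomputable def smallSquareRoots (F : K[X]) (m : ℕ) : Finset K[X] :=
  (degreeLTFinset K F.natDegree).filter fun x => degMod F (x ^ 2) < m

open Classical in
/-- The pairs of elements of `smallSquareRoots F m` with sum `l`. -/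
noncomputable def rootPairs (F : K[X]) (m : ℕ) (l : K[X]) : Finset (K[X] × K[X]) :=
  (smallSquareRoots F m ×ˢ smallSquareRoots F m).filter fun p => p.1 + p.2 = l

variable {F : K[X]} {m : ℕ}

theorem mem_smallSquareRoots {x : K[X]} :
    x ∈ smallSquareRoots F m ↔ x.degree < F.natDegree ∧ degMod F (x ^ 2) < m := by
  classical
  rw [smallSquareRoots, Finset.mem_filter, mem_degreeLTFinset]

theorem mem_rootPairs {l : K[X]} {p : K[X] × K[X]} : p ∈ rootPairs F m l ↔
    (p.1 ∈ smallSquareRoots F m ∧ p.2 ∈ smallSquareRoots F m) ∧ p.1 + p.2 = l := by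
  classical
  rw [rootPairs, Finset.mem_filter, Finset.mem_product]

theorem degree_add_lt_of_mem_smallSquareRoots {x y : K[X]} (hx : x ∈ smallSquareRoots F m)
    (hy : y ∈ smallSquareRoots F m) : (x + y).degree < F.natDegree :=
  (degree_add_le _ _).trans_lt
    (max_lt (mem_smallSquareRoots.1 hx).1 (mem_smallSquareRoots.1 hy).1)

open Classical in
theorem modularRootEnergy_eq_addEnergy (hF : F ≠ 0) :
    modularRootEnergy F m = (smallSquareRoots F m).addEnergy (smallSquareRoots F m) := by
  rw [modularRootEnergy, Finset.addEnergy, ← Set.ncard_coe_finset]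
  refine Set.ncard_congr (fun x _ => ((x 0, x 2), (x 1, x 3))) ?_ ?_ ?_
  · rintro x ⟨hdeg, hsq, hdvd⟩
    rw [degree_eq_natDegree hF] at hdeg
    have hroot : ∀ i, x i ∈ smallSquareRoots F m := fun i =>
      mem_smallSquareRoots.2 ⟨hdeg i, hsq i⟩
    simp only [Finset.coe_filter, Finset.mem_product, Set.mem_ofPred_eq, hroot, and_self, true_and]
    exact eq_of_dvd_sub_of_degree_lt hF (degree_add_lt_of_mem_smallSquareRoots (hroot 0) (hroot 1))
      (degree_add_lt_of_mem_smallSquareRoots (hroot 2) (hroot 3)) hdvd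
  · intro x y _ _ hxy
    simp only [Prod.mk.injEq] at hxy
    funext i
    fin_cases i
    exacts [hxy.1.1, hxy.2.1, hxy.1.2, hxy.2.2]
  · rintro ⟨⟨x₀, x₂⟩, x₁, x₃⟩ hx
    simp only [Finset.coe_filter, Finset.mem_product, Set.mem_ofPred_eq, mem_smallSquareRoots,
      ← degree_eq_natDegree hF] at hx
    obtain ⟨⟨⟨h₀, h₂⟩, h₁, h₃⟩, hsum⟩ := hx
    refine ⟨![x₀, x₁, x₂, x₃], ⟨?_, ?_, ?_⟩, rfl⟩
    · simp [Fin.forall_fin_succ, h₀.1, h₁.1, h₂.1, h₃.1]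
    · simp [Fin.forall_fin_succ, h₀.2, h₁.2, h₂.2, h₃.2]
    · simp [hsum]

open scoped Pointwise in
theorem modularRootEnergy_eq_sum (hF : F ≠ 0) :
    modularRootEnergy F m =
      ∑ l ∈ degreeLTFinset K F.natDegree, (rootPairs F m l).card ^ 2 := by
  classical
  rw [modularRootEnergy_eq_addEnergy hF, Finset.addEnergy_eq_sum_sq']
  refine (Finset.sum_congr rfl fun l _ => by rw [rootPairs]).trans
    (Finset.sum_subset (fun l hl => ?_) fun l _ hl => ?_)
  · obtain ⟨x, hx, y, hy, rfl⟩ := Finset.mem_add.1 hl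
    exact mem_degreeLTFinset.2 (degree_add_lt_of_mem_smallSquareRoots hx hy)
  · rw [sq_eq_zero_iff, Finset.card_eq_zero, Finset.eq_empty_iff_forall_notMem]
    intro p hp
    obtain ⟨⟨hx, hy⟩, hsum⟩ := mem_rootPairs.1 hp
    exact hl (Finset.mem_add.2 ⟨_, hx, _, hy, hsum⟩)

theorem sum_card_rootPairs (F : K[X]) (m : ℕ) :
    ∑ l ∈ degreeLTFinset K F.natDegree, (rootPairs F m l).card =
      (smallSquareRoots F m).card ^ 2 := by
  classical
  rw [sq, ← Finset.card_product]
  refine (Finset.card_eq_sum_card_fiberwise fun p hp => ?_).symm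
  have hp := Finset.mem_product.1 hp
  exact mem_degreeLTFinset.2 (degree_add_lt_of_mem_smallSquareRoots hp.1 hp.2)

theorem card_rootPairs_le (F : K[X]) (m : ℕ) (l : K[X]) :
    (rootPairs F m l).card ≤ (smallSquareRoots F m).card := by
  refine Finset.card_le_card_of_injOn Prod.fst (fun p hp => (mem_rootPairs.1 hp).1.1)
    fun p hp p' hp' h => Prod.ext h ?_
  have hsum := (mem_rootPairs.1 hp).2.trans (mem_rootPairs.1 hp').2.symm
  rw [h] at hsum
  exact add_left_cancel hsum

theorem card_smallSquareRoots_le (hF : Irreducible F) (m : ℕ) :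
    (smallSquareRoots F m).card ≤ 2 * Fintype.card K ^ m := by
  classical
  have hfiber : ∀ x ∈ smallSquareRoots F m, ∀ y ∈ smallSquareRoots F m,
      x ^ 2 % F = y ^ 2 % F → x ∈ ({y, -y} : Finset K[X]) := by
    intro x hx y hy hxy
    rw [Finset.mem_insert, Finset.mem_singleton]
    refine eq_or_eq_neg_of_dvd_sq_sub_sq hF (mem_smallSquareRoots.1 hx).1
      (mem_smallSquareRoots.1 hy).1 ?_
    rw [← EuclideanDomain.mod_eq_zero, Polynomial.sub_mod, hxy, sub_self]
  calc (smallSquareRoots F m).card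
      ≤ 2 * ((smallSquareRoots F m).image fun x => x ^ 2 % F).card := by
        refine Finset.card_le_mul_card_image _ 2 (Finset.forall_mem_image.2 fun y hy => ?_)
        refine (Finset.card_le_card (t := {y, -y}) fun x hx => ?_).trans Finset.card_le_two
        exact hfiber x (Finset.mem_filter.1 hx).1 y hy (Finset.mem_filter.1 hx).2
    _ ≤ 2 * Fintype.card K ^ m := by
        rw [← card_degreeLTFinset]
        gcongr
        exact Finset.image_subset_iff.2 fun x hx =>
          mem_degreeLTFinset.2 (mem_smallSquareRoots.1 hx).2

theorem card_rootPairs_le_card_parabolaPoints (hF : Irreducible F) (h2 : (2 : K) ≠ 0)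
    {l : K[X]} (hl : l.degree < F.natDegree) (hl0 : l ≠ 0) :
    (rootPairs F m l).card ≤ (parabolaPoints F (2 * l ^ 2) (l ^ 4) m).card := by
  have hmod : ∀ x : K[X], F ∣ x ^ 2 % F - x ^ 2 := fun x => dvd_mod_sub F (x ^ 2)
  refine Finset.card_le_card_of_injOn
    (fun p => (p.2 ^ 2 % F - p.1 ^ 2 % F, p.1 ^ 2 % F + p.2 ^ 2 % F)) ?_ ?_
  · rintro ⟨x, y⟩ hxy
    obtain ⟨⟨hx, hy⟩, hsum⟩ := mem_rootPairs.1 hxy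
    obtain rfl : x + y = l := hsum
    have hx := (mem_smallSquareRoots.1 hx).2
    have hy := (mem_smallSquareRoots.1 hy).2
    refine mem_parabolaPoints.2 ⟨⟨(degree_sub_le _ _).trans_lt (max_lt hy hx),
      (degree_add_le _ _).trans_lt (max_lt hx hy)⟩, ?_⟩
    dsimp only
    obtain ⟨d, hd⟩ := hmod x
    obtain ⟨e, he⟩ := hmod y
    rw [eq_add_of_sub_eq hd, eq_add_of_sub_eq he]
    exact ⟨(e - d) * (2 * (y ^ 2 - x ^ 2) + F * (e - d)) - 2 * (x + y) ^ 2 * (d + e), by ring⟩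
  · rintro ⟨x, y⟩ hxy ⟨x', y'⟩ hxy' heq
    obtain ⟨⟨hx, -⟩, hsum⟩ := mem_rootPairs.1 hxy
    obtain ⟨⟨hx', -⟩, hsum'⟩ := mem_rootPairs.1 hxy'
    simp only [Prod.mk.injEq] at heq hsum hsum'
    have hdvd : F ∣ 2 * l ^ 2 * (x - x') := by
      convert (dvd_sub (dvd_sub (hmod y) (hmod x)) (dvd_sub (hmod y') (hmod x'))).mul_left l
        using 1
      linear_combination -l * heq.1 - l * (x - y - l) * hsum + l * (x' - y' - l) * hsum'
    have hxx' : x = x' := eq_of_dvd_sub_of_degree_lt hF.ne_zero (mem_smallSquareRoots.1 hx).1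
      (mem_smallSquareRoots.1 hx').1
      ((hF.prime.dvd_or_dvd hdvd).resolve_left (not_dvd_two_mul_sq hF h2 hl hl0))
    rw [← hsum', hxx'] at hsum
    exact Prod.ext hxx' (add_left_cancel hsum)

open Classical in
theorem card_filter_dvd_sub_two_mul_sq_mul_le (hF : Irreducible F) (h2 : (2 : K) ≠ 0)
    {a : K[X]} (ha : ¬ F ∣ a) (c : K[X]) :
    ((degreeLTFinset K F.natDegree).filter fun l => F ∣ c - 2 * l ^ 2 * a).card ≤ 2 := by
  rcases ((degreeLTFinset K F.natDegree).filter
    fun l => F ∣ c - 2 * l ^ 2 * a).eq_empty_or_nonempty with h | ⟨l, hl⟩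
  · rw [h, Finset.card_empty]
    exact zero_le_two
  refine (Finset.card_le_card (t := {l, -l}) fun l' hl' => ?_).trans Finset.card_le_two
  obtain ⟨hl, hdvd⟩ := Finset.mem_filter.1 hl
  obtain ⟨hl', hdvd'⟩ := Finset.mem_filter.1 hl'
  have h : F ∣ 2 * ((l' ^ 2 - l ^ 2) * a) := by
    convert dvd_sub hdvd hdvd' using 1
    ring
  rw [(isUnit_two_of_two_ne_zero h2).dvd_mul_left] at h
  rw [Finset.mem_insert, Finset.mem_singleton]
  exact eq_or_eq_neg_of_dvd_sq_sub_sq hF (mem_degreeLTFinset.1 hl') (mem_degreeLTFinset.1 hl)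
    ((hF.prime.dvd_or_dvd h).resolve_right ha)

open Classical in
theorem sum_fractionWeight_dvd_le (hF : Irreducible F) (h2 : (2 : K) ≠ 0)
    (hm : m ≤ F.natDegree) (n : ℕ) :
    ∑ l ∈ degreeLTFinset K F.natDegree,
      ∑ x ∈ nonzeroDegreeLTFinset K m ×ˢ nonzeroDegreeLTFinset K n with
        F ∣ x.2 - 2 * l ^ 2 * x.1, fractionWeight x.1 x.2 ≤
      2 * (Fintype.card K * m * (Fintype.card K * n) ^ 2) := by
  rw [Finset.sum_comm' (t' := nonzeroDegreeLTFinset K m ×ˢ nonzeroDegreeLTFinset K n)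
    (s' := fun x => (degreeLTFinset K F.natDegree).filter fun l => F ∣ x.2 - 2 * l ^ 2 * x.1)
    fun l x => by simp only [Finset.mem_filter]; tauto]
  calc _ ≤ ∑ x ∈ nonzeroDegreeLTFinset K m ×ˢ nonzeroDegreeLTFinset K n,
          2 * fractionWeight x.1 x.2 := by
        refine Finset.sum_le_sum fun x hx => ?_
        obtain ⟨ha, ham⟩ := mem_nonzeroDegreeLTFinset.1 (Finset.mem_product.1 hx).1
        rw [Finset.sum_const, nsmul_eq_mul]
        refine mul_le_mul_of_nonneg_right ?_ (fractionWeight_nonneg _ _)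
        exact_mod_cast card_filter_dvd_sub_two_mul_sq_mul_le hF h2
          (fun h => (ham.trans_le hm).not_ge (natDegree_le_of_dvd h ha)) x.2
    _ ≤ _ := by
        rw [← Finset.mul_sum, Finset.sum_product]
        gcongr
        exact sum_fractionWeight_le K m n

theorem sq_le_mul_add_of_sq_le_sq_add {x A B : ℝ} (hA : 0 ≤ A) (hB : 0 ≤ B)
    (h : x ^ 2 ≤ A ^ 2 + B) (hx : 0 ≤ x) : x ^ 2 ≤ A * x + B := by
  rcases le_total x A with hxA | hAx
  · rw [sq]
    exact le_add_of_le_of_nonneg (mul_le_mul_of_nonneg_right hxA hx) hB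
  · refine h.trans (add_le_add_left ?_ B)
    rw [sq]
    exact mul_le_mul_of_nonneg_left hAx hA

open Classical in
theorem card_rootPairs_sq_le (hF : Irreducible F) (h2 : (2 : K) ≠ 0) (hm : m ≤ F.natDegree)
    {l : K[X]} (hl : l.degree < F.natDegree) (hl0 : l ≠ 0) :
    ((rootPairs F m l).card : ℝ) ^ 2 ≤
      2 * maxDivisors K (2 * m) * (Fintype.card K : ℝ) ^ ((3 * m + 1 - F.natDegree) / 2) *
          (rootPairs F m l).card +
        4 * (maxDivisors K (2 * m) : ℝ) ^ 2 *
          (Fintype.card K : ℝ) ^ ((3 * m + 1 - F.natDegree) / 2 + 2 * m + 1) *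
          ∑ x ∈ nonzeroDegreeLTFinset K m ×ˢ nonzeroDegreeLTFinset K (2 * m) with
            F ∣ x.2 - 2 * l ^ 2 * x.1, fractionWeight x.1 x.2 := by
  obtain ⟨a, c, h⟩ := exists_isSmallRatio hF (not_dvd_two_mul_sq hF h2 hl hl0) hm
  have hcard := card_rootPairs_le_card_parabolaPoints (m := m) hF h2 hl hl0
  refine sq_le_mul_add_of_sq_le_sq_add (by positivity)
    (mul_nonneg (by positivity) (Finset.sum_nonneg fun _ _ => fractionWeight_nonneg _ _)) ?_
    (Nat.cast_nonneg _)
  exact (pow_le_pow_left₀ (Nat.cast_nonneg _) (Nat.cast_le.2 hcard) 2).trans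
    (h.card_parabolaPoints_sq_le hF h2 (by omega))

theorem modularRootEnergy_le_card_smallSquareRoots (hF : Irreducible F) (h2 : (2 : K) ≠ 0)
    (hm : m ≤ F.natDegree) :
    (modularRootEnergy F m : ℝ) ≤ ((smallSquareRoots F m).card : ℝ) ^ 2 +
      2 * maxDivisors K (2 * m) * (Fintype.card K : ℝ) ^ ((3 * m + 1 - F.natDegree) / 2) *
        ((smallSquareRoots F m).card : ℝ) ^ 2 +
      4 * (maxDivisors K (2 * m) : ℝ) ^ 2 *
        (Fintype.card K : ℝ) ^ ((3 * m + 1 - F.natDegree) / 2 + 2 * m + 1) *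
        (2 * (Fintype.card K * m * (Fintype.card K * (2 * m : ℕ)) ^ 2)) := by
  classical
  have h0 : (0 : K[X]) ∈ degreeLTFinset K F.natDegree :=
    mem_degreeLTFinset.2 (degree_zero.trans_lt (WithBot.bot_lt_coe _))
  have hweight := sum_fractionWeight_dvd_le hF h2 hm (2 * m)
  have hsum : ∑ l ∈ degreeLTFinset K F.natDegree, ((rootPairs F m l).card : ℝ) =
      ((smallSquareRoots F m).card : ℝ) ^ 2 := by
    exact_mod_cast sum_card_rootPairs F m
  rw [modularRootEnergy_eq_sum hF.ne_zero, ← Finset.add_sum_erase _ _ h0, ← hsum, add_assoc]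
  push_cast
  refine add_le_add ?_ ?_
  · rw [hsum]
    gcongr
    exact card_rootPairs_le F m 0
  refine (Finset.sum_le_sum fun l hl => card_rootPairs_sq_le hF h2 hm
    (mem_degreeLTFinset.1 (Finset.mem_erase.1 hl).2) (Finset.mem_erase.1 hl).1).trans ?_
  rw [Finset.sum_add_distrib, ← Finset.mul_sum, ← Finset.mul_sum]
  have herase : ∀ f : K[X] → ℝ, (∀ l, 0 ≤ f l) →
      ∑ l ∈ (degreeLTFinset K F.natDegree).erase 0, f l ≤
        ∑ l ∈ degreeLTFinset K F.natDegree, f l := fun f hf =>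
    Finset.sum_le_sum_of_subset_of_nonneg (Finset.erase_subset _ _) fun l _ _ => hf l
  push_cast at hweight
  exact add_le_add
    (mul_le_mul_of_nonneg_left (herase _ fun _ => Nat.cast_nonneg _) (by positivity))
    (mul_le_mul_of_nonneg_left
      ((herase _ fun l => Finset.sum_nonneg fun _ _ => fractionWeight_nonneg _ _).trans hweight)
      (by positivity))

theorem modularRootEnergy_le (hF : Irreducible F) (h2 : (2 : K) ≠ 0) (hm : m ≤ F.natDegree) :
    (modularRootEnergy F m : ℝ) ≤
      44 * (Fintype.card K : ℝ) ^ 4 * (maxDivisors K (2 * m) : ℝ) ^ 2 * ((m : ℝ) + 1) ^ 3 *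
        (Fintype.card K : ℝ) ^ (2 * m + (3 * m + 1 - F.natDegree) / 2) := by
  set Z := (3 * m + 1 - F.natDegree) / 2
  set q : ℝ := (Fintype.card K : ℝ)
  set T : ℝ := (maxDivisors K (2 * m) : ℝ)
  have hq : 1 ≤ q := Nat.one_le_cast.2 Fintype.card_pos
  have hT : 1 ≤ T := Nat.one_le_cast.2 (maxDivisors_pos K (2 * m))
  have hS : ((smallSquareRoots F m).card : ℝ) ≤ 2 * q ^ m :=
    (Nat.cast_le.2 (card_smallSquareRoots_le hF m)).trans_eq (by push_cast; rfl)
  calc (modularRootEnergy F m : ℝ)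
      ≤ ((smallSquareRoots F m).card : ℝ) ^ 2 +
          2 * T * q ^ Z * ((smallSquareRoots F m).card : ℝ) ^ 2 +
          4 * T ^ 2 * q ^ (Z + 2 * m + 1) * (2 * (q * m * (q * (2 * m : ℕ)) ^ 2)) :=
        modularRootEnergy_le_card_smallSquareRoots hF h2 hm
    _ ≤ (2 * q ^ m) ^ 2 + 2 * T * q ^ Z * (2 * q ^ m) ^ 2 +
          4 * T ^ 2 * q ^ (Z + 2 * m + 1) * (2 * (q * m * (q * (2 * m : ℕ)) ^ 2)) := by gcongr
    _ = 4 * (1 * 1 * 1 * q ^ (2 * m)) + 8 * (1 * T * 1 * q ^ (2 * m + Z)) +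
          32 * (q ^ 4 * T ^ 2 * m ^ 3 * q ^ (2 * m + Z)) := by
        push_cast
        ring
    _ ≤ 4 * (q ^ 4 * T ^ 2 * (m + 1) ^ 3 * q ^ (2 * m + Z)) +
          8 * (q ^ 4 * T ^ 2 * (m + 1) ^ 3 * q ^ (2 * m + Z)) +
            32 * (q ^ 4 * T ^ 2 * (m + 1) ^ 3 * q ^ (2 * m + Z)) := by
        have hq4 : 1 ≤ q ^ 4 := one_le_pow₀ hq
        have hT2 : T ≤ T ^ 2 := le_self_pow₀ hT two_ne_zero
        have hm1 : (1 : ℝ) ≤ (m + 1) ^ 3 := one_le_pow₀ (by simp)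
        gcongr
        · exact hT.trans hT2
        · exact Nat.le_add_right _ _
        · exact le_add_of_nonneg_right zero_le_one
    _ = 44 * q ^ 4 * T ^ 2 * (m + 1) ^ 3 * q ^ (2 * m + Z) := by ring

end Energy

section Asymptotics

variable (K : Type*) [Field K] [Fintype K]

theorem isLittleO_const_natCast (x : ℝ) :
    (fun _ : ℕ => x) =o[atTop] fun n : ℕ => (n : ℝ) :=
  isLittleO_const_left.2 (.inr (tendsto_norm_atTop_atTop.comp tendsto_natCast_atTop_atTop))

theorem isLittleO_log_natCast_add_one :
    (fun n : ℕ => Real.log ((n : ℝ) + 1)) =o[atTop] fun n : ℕ => (n : ℝ) := by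
  have htend : Tendsto (fun n : ℕ => (n : ℝ) + 1) atTop atTop :=
    tendsto_atTop_add_const_right _ _ tendsto_natCast_atTop_atTop
  exact (Real.isLittleO_log_id_atTop.comp_tendsto htend).trans_isBigO
    ((isBigO_refl _ _).add (isLittleO_const_natCast 1).isBigO)

theorem log_maxDivisors_le (n D : ℕ) :
    Real.log (maxDivisors K n) ≤
      Real.log (Fintype.card K) + (Fintype.card K : ℝ) ^ (D + 1) * Real.log ((n : ℝ) + 1) +
        n / (D + 1) := by
  have hq : (0 : ℝ) < Fintype.card K := by exact_mod_cast Fintype.card_pos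
  have hT : (0 : ℝ) < maxDivisors K n := by exact_mod_cast maxDivisors_pos K n
  have hbound : (maxDivisors K n : ℝ) ≤ Fintype.card K *
      (((n : ℝ) + 1) ^ Fintype.card K ^ (D + 1) * 2 ^ (n / (D + 1))) := by
    exact_mod_cast maxDivisors_le K n D
  have hfloor : ((n / (D + 1) : ℕ) : ℝ) ≤ n / (D + 1) := by
    exact_mod_cast Nat.cast_div_le (α := ℝ) (m := n) (n := D + 1)
  have hlog2 : Real.log 2 ≤ 1 := Real.log_two_lt_d9.le.trans (by norm_num)
  calc Real.log (maxDivisors K n)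
      ≤ Real.log (Fintype.card K *
          (((n : ℝ) + 1) ^ Fintype.card K ^ (D + 1) * 2 ^ (n / (D + 1)))) :=
        Real.log_le_log hT hbound
    _ = Real.log (Fintype.card K) + (Fintype.card K : ℝ) ^ (D + 1) * Real.log ((n : ℝ) + 1) +
          (n / (D + 1) : ℕ) * Real.log 2 := by
        rw [Real.log_mul hq.ne' (by positivity), Real.log_mul (by positivity) (by positivity),
          Real.log_pow, Real.log_pow, Nat.cast_pow, ← add_assoc]
    _ ≤ _ := add_le_add_right ((mul_le_of_le_one_right (Nat.cast_nonneg _) hlog2).trans hfloor) _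

theorem isLittleO_log_maxDivisors :
    (fun n : ℕ => Real.log (maxDivisors K n)) =o[atTop] fun n : ℕ => (n : ℝ) := by
  rw [isLittleO_iff]
  intro ε hε
  obtain ⟨D, hD⟩ := exists_nat_gt (2 / ε)
  have hmain : (fun n : ℕ => Real.log (Fintype.card K) +
      (Fintype.card K : ℝ) ^ (D + 1) * Real.log ((n : ℝ) + 1)) =o[atTop] fun n : ℕ => (n : ℝ) :=
    (isLittleO_const_natCast _).add (isLittleO_log_natCast_add_one.const_mul_left _)
  filter_upwards [isLittleO_iff.1 hmain (half_pos hε)] with n hn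
  have hlog : 0 ≤ Real.log (maxDivisors K n) :=
    Real.log_nonneg (by exact_mod_cast maxDivisors_pos K n)
  have htail : (n : ℝ) / (D + 1) ≤ ε / 2 * n := by
    rw [div_lt_iff₀ hε] at hD
    rw [div_le_iff₀ (by positivity)]
    nlinarith [mul_nonneg hε.le (Nat.cast_nonneg (α := ℝ) n), Nat.cast_nonneg (α := ℝ) n]
  rw [Real.norm_natCast] at hn ⊢
  rw [Real.norm_of_nonneg hlog]
  linarith [log_maxDivisors_le K n D, (le_abs_self _).trans hn]

/-- The subexponential factor `q ^ g m` in the energy bound. It has one more factor `q` than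
`modularRootEnergy_le`, to absorb the rounding in the exponent there. -/
noncomputable def energyFactor (m : ℕ) : ℝ :=
  44 * (Fintype.card K : ℝ) ^ 5 * (maxDivisors K (2 * m) : ℝ) ^ 2 * ((m : ℝ) + 1) ^ 3

theorem energyFactor_pos (m : ℕ) : 0 < energyFactor K m := by
  have hT : (0 : ℝ) < maxDivisors K (2 * m) := by exact_mod_cast maxDivisors_pos K (2 * m)
  unfold energyFactor
  positivity

theorem log_energyFactor (m : ℕ) :
    Real.log (energyFactor K m) = Real.log (44 * (Fintype.card K : ℝ) ^ 5) +
      2 * Real.log (maxDivisors K (2 * m)) + 3 * Real.log ((m : ℝ) + 1) := by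
  have hT : (0 : ℝ) < maxDivisors K (2 * m) := by exact_mod_cast maxDivisors_pos K (2 * m)
  rw [energyFactor, Real.log_mul (by positivity) (by positivity),
    Real.log_mul (by positivity) (by positivity), Real.log_pow, Real.log_pow]
  norm_cast

theorem isLittleO_logb_energyFactor (b : ℝ) :
    (fun m : ℕ => Real.logb b (energyFactor K m)) =o[atTop] fun m : ℕ => (m : ℝ) := by
  have hdouble : Tendsto (fun m : ℕ => 2 * m) atTop atTop :=
    tendsto_id.const_mul_atTop' two_pos
  have hdiv : (fun m : ℕ => Real.log (maxDivisors K (2 * m))) =o[atTop] fun m : ℕ => (m : ℝ) := by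
    refine ((isLittleO_log_maxDivisors K).comp_tendsto hdouble).trans_isBigO ?_
    refine ((isBigO_refl (fun m : ℕ => (m : ℝ)) atTop).const_mul_left 2).congr_left fun m => ?_
    exact (Nat.cast_mul 2 m).symm
  simp only [Real.logb, log_energyFactor, div_eq_inv_mul]
  exact (((isLittleO_const_natCast _).add (hdiv.const_mul_left 2)).add
    (isLittleO_log_natCast_add_one.const_mul_left 3)).const_mul_left _

end Asymptotics

theorem pow_le_mul_rpow_add_rpow {q : ℝ} (hq : 1 ≤ q) (m r : ℕ) :
    q ^ (2 * m + (3 * m + 1 - r) / 2) ≤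
      q * (q ^ (7 * (m : ℝ) / 2 - (r : ℝ) / 2) + q ^ (2 * (m : ℝ))) := by
  have hq0 : 0 < q := one_pos.trans_le hq
  rw [mul_add, ← Real.rpow_natCast]
  rcases le_or_gt (3 * m) r with hmr | hmr
  · rw [show 2 * m + (3 * m + 1 - r) / 2 = 2 * m by omega]
    push_cast
    exact le_add_of_nonneg_of_le (by positivity) (le_mul_of_one_le_left (by positivity) hq)
  · have hexp : ((2 * m + (3 * m + 1 - r) / 2 : ℕ) : ℝ) ≤
        1 + (7 * (m : ℝ) / 2 - (r : ℝ) / 2) := by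
      have hdouble : (2 : ℝ) * (2 * m + (3 * m + 1 - r) / 2 : ℕ) + r ≤ 2 + 7 * m := by
        exact_mod_cast (by omega : 2 * (2 * m + (3 * m + 1 - r) / 2) + r ≤ 2 + 7 * m)
      linarith
    refine le_add_of_le_of_nonneg ?_ (by positivity)
    calc _ ≤ q ^ (1 + (7 * (m : ℝ) / 2 - (r : ℝ) / 2)) := Real.rpow_le_rpow_of_exponent_le hq hexp
      _ = _ := by rw [Real.rpow_add hq0, Real.rpow_one]

theorem two_ne_zero_of_odd_card {K : Type*} [Field K] [Fintype K] (h : Odd (Fintype.card K)) :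
    (2 : K) ≠ 0 :=
  Ring.two_ne_zero fun hchar =>
    Nat.not_even_iff_odd.2 h (Nat.even_iff.2 (FiniteField.even_card_iff_char_two.1 hchar))

theorem theorem2p6 {K : Type*} [Field K] [Fintype K] (q : ℕ) (hq : Fintype.card K = q)
    (hodd : Odd q) :
    ∃ g : ℕ → ℝ, (g =o[atTop] fun m : ℕ => (m : ℝ)) ∧
      ∀ (F : K[X]) (r m : ℕ), Irreducible F → F.natDegree = r → m ≤ r →
        (modularRootEnergy F m : ℝ) ≤
          (q : ℝ) ^ g m *
            ((q : ℝ) ^ (7 * (m : ℝ) / 2 - (r : ℝ) / 2) + (q : ℝ) ^ (2 * (m : ℝ))) := by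
  subst hq
  have hq1 : (1 : ℝ) < Fintype.card K := by exact_mod_cast Fintype.one_lt_card
  refine ⟨fun m => Real.logb (Fintype.card K) (energyFactor K m),
    isLittleO_logb_energyFactor K _, ?_⟩
  rintro F _ m hF rfl hm
  rw [Real.rpow_logb (one_pos.trans hq1) hq1.ne' (energyFactor_pos K m)]
  calc (modularRootEnergy F m : ℝ)
      ≤ 44 * (Fintype.card K : ℝ) ^ 4 * (maxDivisors K (2 * m) : ℝ) ^ 2 * ((m : ℝ) + 1) ^ 3 *
          (Fintype.card K : ℝ) ^ (2 * m + (3 * m + 1 - F.natDegree) / 2) :=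
        modularRootEnergy_le hF (two_ne_zero_of_odd_card hodd) hm
    _ ≤ 44 * (Fintype.card K : ℝ) ^ 4 * (maxDivisors K (2 * m) : ℝ) ^ 2 * ((m : ℝ) + 1) ^ 3 *
          (Fintype.card K * ((Fintype.card K : ℝ) ^ (7 * (m : ℝ) / 2 - (F.natDegree : ℝ) / 2) +
            (Fintype.card K : ℝ) ^ (2 * (m : ℝ)))) := by
        gcongr
        exact pow_le_mul_rpow_add_rpow hq1.le m F.natDegree
    _ = _ := by
        rw [energyFactor]
        ring
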